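/- **Notation.** $\mathbb{R}^n,\mathbb{R}^m$ carry the Euclidean inner product and norm. For $C\subset\mathbb{R}^n$ and $x\in C$, the regular normal cone $\widehat N_C(x)$ is the set of $v$ with $\langle v,x'-x\rangle\le o(\|x'-x\|_2)$ for $x'\in C$, and the normal cone is $N_C(x)=\{v\mid \exists\, v^\nu\to v,\ x^\nu\in C\to x,\ v^\nu\in\widehat N_C(x^\nu)\}$; both are empty if $x\notin C$. For $h:\mathbb{R}^m\to[-\infty,\infty]$, $\operatorname{dom}h=\{z\mid h(z)<\infty\}$, $\operatorname{epi}h=\{(z,\alpha)\in\mathbb{R}^m\times\mathbb{R}\mid h(z)\le\alpha\}$, and $\partial h(z)=\{v\mid (v,-1)\in N_{\operatorname{epi}h}(z,h(z))\}$ if $h(z)\in\mathbb{R}$, $\partial h(z)=\emptyset$ otherwise. $h$ is proper if $\operatorname{epi}h\ne\emptyset$ and $h>-\infty$; it is lsc (convex) if $\operatorname{epi}h$ is closed (convex). Sets $C^\nu$ *set-converge* to $C$ if every limit of points $x^\nu\in C^\nu$ along a subsequence of $\mathbb{N}$ lies in $C$ and every point of $C$ is the limit of a sequence $x^\nu\in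 C^\nu$, $\nu\in\mathbb{N}$; $h^\nu$ *epi-converges* to $h$ if $\operatorname{epi}h^\nu$ set-converges to $\operatorname{epi}h$. $\operatorname{con}$ is the convex hull, sums and multiples of sets are Minkowski sums and multiples, and $\operatorname{dist}(0,C)=\inf_{c\in C}\|c\|_2$, with $\operatorname{dist}(0,\emptyset)=\infty$. "Smooth" means $C^1$. **Theorem.** Let $X,X^\nu\subset\mathbb{R}^n$ ($\nu\in\mathbb{N}$) be nonempty and closed, and suppose that either $X$ and all $X^\nu$ are convex, or $X^\nu=X$ for all $\nu$. Let $h,h^\nu:\mathbb{R}^m\to[-\infty,\infty]$ be proper, lsc and convex, $f_0,f_0^\nu:\mathbb{R}^n\to\mathbb{R}$ smooth, $F=(f_1,\dots,f_m)$ and $F^\nu=(f_1^\nu,\dots,f_m^\nu):\mathbb{R}^n\to\mathbb{R}^m$ locally Lipschitz continuous, and $D_i,D_i^\nu:\mathbb{R}^n\rightrightarrows\mathbb{R}^n$ set-valued mappings, $i=1,\dots,m$. Define $$S(x,y,z)=\{F(x)-z\}\times\big(\partial h(z)-y\big)\times\Big(\nabla f_0(x)+\sum_{i=1}^m y_i\operatorname{con}D_i(x)+N_X(x)\Big),$$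 and $S^\nu$ in the same way from $F^\nu,h^\nu,f_0^\nu,D_i^\nu,X^\nu$. Suppose that (a) $X^\nu$ set-converges to $X$; (b) $h^\nu$ epi-converges to $h$; (c) $f_0^\nu(x^\nu)\to f_0(x)$ and $\nabla f_0^\nu(x^\nu)\to\nabla f_0(x)$ whenever $x^\nu\in X^\nu\to x$; (d) for each $i$, whenever $x^\nu\in X^\nu\to x$ and $v^\nu\in D_i^\nu(x^\nu)$ for all $\nu\in\mathbb{N}$, one has $f_i^\nu(x^\nu)\to f_i(x)$ and $\{v^\nu\}$ is bounded with all its cluster points in $\operatorname{con}D_i(x)$. Then the following hold. (i) Assume $D_i^\nu(x)\neq\emptyset$ for all $\nu$, $i$ and $x\in X^\nu$. Let $\epsilon^\nu\in[0,\infty)$ with $\epsilon^\nu\to0$, let $\operatorname{dist}(0,S^\nu(x^\nu,y^\nu,z^\nu))\le\epsilon^\nu$ for all $\nu$, and let $x^\nu\to\bar x$ along a subsequence of $\mathbb{N}$. If $F(\bar x)\in\operatorname{dom}h$, suppose that $$y\in N_{\operatorname{dom}h}(F(\bar x))\ \text{ and }\ 0\in\sum_{i=1}^m y_i\operatorname{con}D_i(\bar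 x)+N_X(\bar x)\ \Longrightarrow\ y=0;$$ if $F(\bar x)\notin\operatorname{dom}h$, suppose that $$0\in\sum_{i=1}^m y_i\operatorname{con}D_i(\bar x)+N_X(\bar x)\ \Longrightarrow\ y=0.$$ Then there exist $\bar y,\bar z\in\mathbb{R}^m$ with $0\in S(\bar x,\bar y,\bar z)$. (The sequence $\{y^\nu\}$ is not assumed to be bounded.) (ii) Assume $D_i^\nu(x)\neq\emptyset$ for all $\nu$, $i$ and $x\in X^\nu$. If $\operatorname{dist}(0,S^\nu(x^\nu,y^\nu,z^\nu))\le\epsilon^\nu$ for all $\nu$, with $\epsilon^\nu\in[0,\infty)$, $\epsilon^\nu\to0$, and $(\bar x,\bar y,\bar z)$ is a cluster point of $\{(x^\nu,y^\nu,z^\nu)\}$, then $0\in S(\bar x,\bar y,\bar z)$. (iii) If $F$ and all $F^\nu$ are smooth and $D_i(x)=\{\nabla f_i(x)\}$, $D_i^\nu(x)=\{\nabla f_i^\nu(x)\}$ for all $i$, $\nu$ and $x$, then for every $(\bar x,\bar y,\bar z)$ with $0\in S(\bar x,\bar y,\bar z)$ there are $(x^\nu,y^\nu,z^\nu)\to(\bar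 x,\bar y,\bar z)$ and $\epsilon^\nu\in[0,\infty)$, $\epsilon^\nu\to0$, with $\operatorname{dist}(0,S^\nu(x^\nu,y^\nu,z^\nu))\le\epsilon^\nu$ for all $\nu$. (iv) If $X^\nu=X$, $F^\nu=F$ and $D_i^\nu=D_i$ for all $\nu$ and $i$, then the conclusion of (iii) holds. -/

import Mathlib

open Filter Topology
open scoped Pointwise ENNReal Gradient

namespace GlobalApprox

noncomputable section

/-- `ℝⁿ` with the Euclidean norm. -/
abbrev Rn (n : ℕ) : Type := EuclideanSpace ℝ (Fin n)

section SetLimits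

variable {E : Type*} [TopologicalSpace E]

/-- Inner limit: the limits of sequences with `xs ν ∈ C ν` for all `ν`. -/
def limInn (C : ℕ → Set E) : Set E :=
  {x | ∃ xs : ℕ → E, (∀ ν, xs ν ∈ C ν) ∧ Tendsto xs atTop (𝓝 x)}

/-- Outer limit: the limits of sequences selected from the sets along a subsequence `φ`. -/
def limOut (C : ℕ → Set E) : Set E :=
  {x | ∃ φ : ℕ → ℕ, StrictMono φ ∧
    ∃ xs : ℕ → E, (∀ k, xs k ∈ C (φ k)) ∧ Tendsto xs atTop (𝓝 x)}

/-- Set-convergence of `C ν` to `C₀` (Painlevé–Kuratowski). -/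
def SetConverges (C : ℕ → Set E) (C₀ : Set E) : Prop :=
  limOut C ⊆ C₀ ∧ C₀ ⊆ limInn C

end SetLimits

section Normals

variable {E : Type*} [NormedAddCommGroup E] [InnerProductSpace ℝ E]

/-- Regular normal cone: `⟨v, x' - x⟩ ≤ o(‖x' - x‖)` for `x' ∈ C`; empty when `x ∉ C`. -/
def regularNormalCone (C : Set E) (x : E) : Set E :=
  {v | x ∈ C ∧ ∀ ε : ℝ, 0 < ε → ∀ᶠ x' in 𝓝[C] x, inner ℝ v (x' - x) ≤ ε * ‖x' - x‖}

/-- (Limiting) normal cone; empty when `x ∉ C`. -/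
def normalCone (C : Set E) (x : E) : Set E :=
  {v | x ∈ C ∧ ∃ (xs vs : ℕ → E), (∀ ν, xs ν ∈ C) ∧ Tendsto xs atTop (𝓝 x) ∧
    Tendsto vs atTop (𝓝 v) ∧ ∀ ν, vs ν ∈ regularNormalCone C (xs ν)}

end Normals

section ExtendedReal

variable {m : ℕ}

/-- Effective domain. -/
def effDom (h : Rn m → EReal) : Set (Rn m) := {z | h z < ⊤}

/-- Epigraph, as a subset of `ℝᵐ × ℝ` with the Euclidean (ℓ²) structure. -/
def epi (h : Rn m → EReal) : Set (WithLp 2 (Rn m × ℝ)) :=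
  {p | h p.fst ≤ ((p.snd : ℝ) : EReal)}

/-- Proper, lower semicontinuous and convex, all expressed through the epigraph. -/
structure ProperLscConvex (h : Rn m → EReal) : Prop where
  epi_nonempty : (epi h).Nonempty
  ne_bot : ∀ z, h z ≠ ⊥
  epi_closed : IsClosed (epi h)
  epi_convex : Convex ℝ (epi h)

/-- Epi-convergence: set-convergence of the epigraphs. -/
def EpiConverges (hν : ℕ → Rn m → EReal) (h : Rn m → EReal) : Prop :=
  SetConverges (fun ν => epi (hν ν)) (epi h)

/-- Subdifferential: `v` with `(v, -1)` normal to the epigraph at `(z, h z)`;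
empty where `h` is not finite. -/
def subdiff (h : Rn m → EReal) (z : Rn m) : Set (Rn m) :=
  {v | h z ≠ ⊥ ∧ h z ≠ ⊤ ∧
    WithLp.toLp 2 (v, (-1 : ℝ)) ∈ normalCone (epi h) (WithLp.toLp 2 (z, (h z).toReal))}

end ExtendedReal

section Stationarity

variable {n m : ℕ}

/-- `∑ᵢ yᵢ con Dᵢ(x) + N_X(x)` (Minkowski operations). -/
def multiplierSet (X : Set (Rn n)) (D : Fin m → Rn n → Set (Rn n)) (x : Rn n) (y : Rn m) :
    Set (Rn n) :=
  (∑ i, y i • convexHull ℝ (D i x)) + normalCone X x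

/-- The set-valued mapping
`S(x,y,z) = {F(x) - z} × (∂h(z) - y) × (∇f₀(x) + ∑ᵢ yᵢ con Dᵢ(x) + N_X(x))`. -/
def statMap (X : Set (Rn n)) (f₀ : Rn n → ℝ) (h : Rn m → EReal) (F : Rn n → Rn m)
    (D : Fin m → Rn n → Set (Rn n)) (x : Rn n) (y z : Rn m) : Set (Rn m × Rn m × Rn n) :=
  {F x - z} ×ˢ ((subdiff h z - {y}) ×ˢ ({∇ f₀ x} + multiplierSet X D x y))

/-- Euclidean distance from the origin to a subset of `ℝᵐ × ℝᵐ × ℝⁿ`; it is `∞` for the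
empty set. -/
def distZero (C : Set (Rn m × Rn m × Rn n)) : ℝ≥0∞ :=
  ⨅ s ∈ C, ENNReal.ofReal (Real.sqrt (‖s.1‖ ^ 2 + ‖s.2.1‖ ^ 2 + ‖s.2.2‖ ^ 2))

/-- Basic qualification at `x`. -/
def BasicQualification (X : Set (Rn n)) (h : Rn m → EReal) (F : Rn n → Rn m)
    (D : Fin m → Rn n → Set (Rn n)) (x : Rn n) : Prop :=
  ∀ y : Rn m, y ∈ normalCone (effDom h) (F x) → 0 ∈ multiplierSet X D x y → y = 0

/-- The qualification used at points `x` with `F x ∉ dom h`. -/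
def InfeasQualification (X : Set (Rn n)) (D : Fin m → Rn n → Set (Rn n)) (x : Rn n) : Prop :=
  ∀ y : Rn m, 0 ∈ multiplierSet X D x y → y = 0

/-- The points `(x ν, y ν, z ν)` are near-stationary for the mappings `Sν ν` with
tolerances `ε ν ∈ [0, ∞)` that vanish. -/
def NearStationary (Sν : ℕ → Rn n → Rn m → Rn m → Set (Rn m × Rn m × Rn n))
    (ε : ℕ → ℝ) (x : ℕ → Rn n) (y z : ℕ → Rn m) : Prop :=
  (∀ ν, 0 ≤ ε ν) ∧ Tendsto ε atTop (𝓝 0) ∧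
    ∀ ν, distZero (Sν ν (x ν) (y ν) (z ν)) ≤ ENNReal.ofReal (ε ν)

/-- Every zero of `S` is the limit of points that are near-stationary for the `Sν ν`
with vanishing tolerances. -/
def ZerosApproximable (S : Rn n → Rn m → Rn m → Set (Rn m × Rn m × Rn n))
    (Sν : ℕ → Rn n → Rn m → Rn m → Set (Rn m × Rn m × Rn n)) : Prop :=
  ∀ (xb : Rn n) (yb zb : Rn m), 0 ∈ S xb yb zb →
    ∃ (x : ℕ → Rn n) (y z : ℕ → Rn m) (ε : ℕ → ℝ),
      Tendsto (fun ν => (x ν, y ν, z ν)) atTop (𝓝 (xb, yb, zb)) ∧ NearStationary Sν ε x y z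

end Stationarity

end

end GlobalApprox

open GlobalApprox

/-! Everything rests on how normal cones and subgradients behave under set-convergence. Normality to
a convex set is a variational inequality over the whole set, so it passes to the limit by testing
against recovery points; for a constant set a diagonal argument does the same
(`mem_normalCone_of_setConverges`). Subgradient inequalities pass through epi-limits likewise
(`mem_subdiff_of_tendsto`), and Carathéodory's theorem keeps cluster points of selections from the
convex hulls inside the limiting hull. Together these give (ii).

For (i) it suffices that the multipliers are bounded along some subsequence, since (ii) then
applies. Otherwise their norms tend to infinity, and dividing the stationarity relations by `‖y‖ +
1` removes the objective gradient and the errors. The scaled multipliers cluster at a unit vector,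
which is normal to `dom h` when `F xb ∈ dom h` (`mem_normalCone_effDom_of_tendsto`) and contradicts
the qualification.

For (iii) and (iv) the passage is reversed. Projecting `x + v` on the approximating convex sets
produces normals converging to a given normal `v` at `x` (`exists_tendsto_normalCone`). Applied to
epigraphs and rescaled, this gives converging subgradients (`exists_tendsto_subdiff`); applied to
the sets `Xν`, it gives the points for (iii). -/

namespace GlobalApprox

/-! ### Normal cones, projections and set-convergence. -/

section NormalConeFacts

variable {E : Type*} [NormedAddCommGroup E] [InnerProductSpace ℝ E]

/-- Regular normals to a convex set satisfy the global variational inequality. -/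
theorem inner_nonpos_of_mem_regularNormalCone {C : Set E} (hC : Convex ℝ C) {x v : E}
    (hv : v ∈ regularNormalCone C x) {x' : E} (hx' : x' ∈ C) : inner ℝ v (x' - x) ≤ 0 := by
  obtain ⟨hx, hv⟩ := hv
  -- The segment towards `x'` stays in `C`; along it the local estimate is homogeneous in `t`, so it
  -- becomes global.
  have hlim : Tendsto (fun t : ℝ => x + t • (x' - x)) (𝓝[>] 0) (𝓝[C] x) := by
    refine tendsto_nhdsWithin_iff.2 ⟨?_, ?_⟩
    · have : Continuous fun t : ℝ => x + t • (x' - x) := by fun_prop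
      simpa using (this.tendsto 0).mono_left nhdsWithin_le_nhds
    · filter_upwards [Ioc_mem_nhdsGT (zero_lt_one' ℝ)] with t ht
      exact hC.add_smul_sub_mem hx hx' ⟨ht.1.le, ht.2⟩
  have key : ∀ ε : ℝ, 0 < ε → inner ℝ v (x' - x) ≤ ε * ‖x' - x‖ := by
    intro ε hε
    obtain ⟨t, ht, ht0⟩ := ((hlim.eventually (hv ε hε)).and self_mem_nhdsWithin).exists
    have ht0 : 0 < t := ht0
    rw [add_sub_cancel_left, inner_smul_right, norm_smul, Real.norm_of_nonneg ht0.le] at ht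
    nlinarith
  have hl : Tendsto (fun ε : ℝ => ε * ‖x' - x‖) (𝓝[>] 0) (𝓝 0) := by
    have : Continuous fun ε : ℝ => ε * ‖x' - x‖ := by fun_prop
    simpa using (this.tendsto 0).mono_left nhdsWithin_le_nhds
  exact ge_of_tendsto hl (eventually_mem_nhdsWithin.mono key)

theorem mem_regularNormalCone_of_inner_nonpos {C : Set E} {x v : E} (hx : x ∈ C)
    (h : ∀ x' ∈ C, inner ℝ v (x' - x) ≤ 0) : v ∈ regularNormalCone C x :=
  ⟨hx, fun ε hε => eventually_mem_nhdsWithin.mono fun x' hx' =>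
    (h x' hx').trans (by positivity)⟩

theorem regularNormalCone_subset_normalCone (C : Set E) (x : E) :
    regularNormalCone C x ⊆ normalCone C x := fun v hv =>
  ⟨hv.1, fun _ => x, fun _ => v, fun _ => hv.1, tendsto_const_nhds, tendsto_const_nhds,
    fun _ => hv⟩

/-- For a convex set, both normal cones are given by the variational inequality. -/
theorem mem_normalCone_iff_of_convex {C : Set E} (hC : Convex ℝ C) {x v : E} :
    v ∈ normalCone C x ↔ x ∈ C ∧ ∀ x' ∈ C, inner ℝ v (x' - x) ≤ 0 := by
  refine ⟨fun ⟨hx, xs, vs, _, hxs, hvs, hreg⟩ => ⟨hx, fun x' hx' => ?_⟩, fun h =>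
    regularNormalCone_subset_normalCone C x (mem_regularNormalCone_of_inner_nonpos h.1 h.2)⟩
  exact le_of_tendsto' (hvs.inner (tendsto_const_nhds.sub hxs)) fun ν =>
    inner_nonpos_of_mem_regularNormalCone hC (hreg ν) hx'

theorem smul_mem_normalCone {C : Set E} {x v : E} (hv : v ∈ normalCone C x) {t : ℝ}
    (ht : 0 < t) : t • v ∈ normalCone C x := by
  obtain ⟨hx, xs, vs, hxC, hxs, hvs, hreg⟩ := hv
  refine ⟨hx, xs, fun ν => t • vs ν, hxC, hxs, hvs.const_smul t, fun ν => ⟨hxC ν, fun ε hε => ?_⟩⟩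
  filter_upwards [(hreg ν).2 (ε / t) (by positivity)] with x' hx'
  rw [real_inner_smul_left]
  calc t * inner ℝ (vs ν) (x' - xs ν) ≤ t * (ε / t * ‖x' - xs ν‖) := by gcongr
    _ = ε * ‖x' - xs ν‖ := by field_simp

/-- The normal cone mapping has closed graph relative to the set. -/
theorem mem_normalCone_of_tendsto {C : Set E} {x v : E} {xs vs : ℕ → E} (hx : x ∈ C)
    (hxs : Tendsto xs atTop (𝓝 x)) (hvs : Tendsto vs atTop (𝓝 v))
    (h : ∀ k, vs k ∈ normalCone C (xs k)) : v ∈ normalCone C x := by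
  -- Diagonal choice: a regular normal pair within `1 / (k + 1)` of the `k`-th pair.
  have happrox : ∀ k : ℕ, ∃ p : E × E, p.2 ∈ regularNormalCone C p.1 ∧
      dist p (xs k, vs k) < 1 / ((k : ℝ) + 1) := by
    intro k
    obtain ⟨_, as, bs, _, has, hbs, hreg⟩ := h k
    have := (has.prodMk_nhds hbs).eventually (Metric.ball_mem_nhds _ (Nat.one_div_pos_of_nat
      (α := ℝ) (n := k)))
    obtain ⟨j, hj⟩ := this.exists
    exact ⟨(as j, bs j), hreg j, hj⟩
  choose p hp hd using happrox
  have hpl : Tendsto p atTop (𝓝 (x, v)) := by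
    refine (tendsto_iff_of_dist ?_).1 (hxs.prodMk_nhds hvs)
    refine squeeze_zero (fun _ => dist_nonneg) (fun k => ?_)
      tendsto_one_div_add_atTop_nhds_zero_nat
    rw [dist_comm]
    exact (hd k).le
  exact ⟨hx, fun k => (p k).1, fun k => (p k).2, fun k => (hp k).1, hpl.fst_nhds, hpl.snd_nhds, hp⟩

/-- Limits of normals to set-converging sets, convex or constant, are normals to the limit. -/
theorem mem_normalCone_of_setConverges {C : Set E} {Cν : ℕ → Set E}
    (hconv : (Convex ℝ C ∧ ∀ ν, Convex ℝ (Cν ν)) ∨ ∀ ν, Cν ν = C)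
    (hC : SetConverges Cν C) {φ : ℕ → ℕ} (hφ : StrictMono φ) {x v : E} {xs vs : ℕ → E}
    (hxs : Tendsto xs atTop (𝓝 x)) (hvs : Tendsto vs atTop (𝓝 v))
    (h : ∀ k, vs k ∈ normalCone (Cν (φ k)) (xs k)) : v ∈ normalCone C x := by
  have hx : x ∈ C := hC.1 ⟨φ, hφ, xs, fun k => (h k).1, hxs⟩
  rcases hconv with ⟨hc, hcν⟩ | heq
  · refine (mem_normalCone_iff_of_convex hc).2 ⟨hx, fun x' hx' => ?_⟩
    obtain ⟨ws, hws, hwl⟩ := hC.2 hx'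
    exact le_of_tendsto' (hvs.inner ((hwl.comp hφ.tendsto_atTop).sub hxs)) fun k =>
      ((mem_normalCone_iff_of_convex (hcν _)).1 (h k)).2 _ (hws _)
  · simp only [heq] at h
    exact mem_normalCone_of_tendsto hx hxs hvs h

/-- Existence of projections on closed convex sets, in variational form. -/
theorem exists_sub_mem_normalCone [CompleteSpace E] {C : Set E} (hne : C.Nonempty)
    (hcl : IsClosed C) (hC : Convex ℝ C) (q : E) : ∃ p, q - p ∈ normalCone C p := by
  obtain ⟨p, hp, hmin⟩ := exists_norm_eq_iInf_of_complete_convex hne hcl.isComplete hC q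
  exact ⟨p, (mem_normalCone_iff_of_convex hC).2
    ⟨hp, (norm_eq_iInf_iff_real_inner_le_zero hC hp).1 hmin⟩⟩

/-- The angle at the projection `p` is obtuse, so the cross term in the expanded square has a
favourable sign. Both minimality and uniqueness of the projection follow. -/
theorem norm_sub_le_of_sub_mem_normalCone {C : Set E} (hC : Convex ℝ C) {p q x : E}
    (hp : q - p ∈ normalCone C p) (hx : x ∈ C) : ‖x - p‖ ^ 2 + ‖q - p‖ ^ 2 ≤ ‖q - x‖ ^ 2 := by
  have h := ((mem_normalCone_iff_of_convex hC).1 hp).2 x hx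
  have : q - x = (q - p) - (x - p) := by abel
  rw [this, norm_sub_sq_real (q - p) (x - p)]
  linarith

/-- Normals to the limit of set-converging closed convex sets are limits of normals. -/
theorem exists_tendsto_normalCone [FiniteDimensional ℝ E] {C : Set E} {Cν : ℕ → Set E}
    (hne : ∀ ν, (Cν ν).Nonempty) (hcl : ∀ ν, IsClosed (Cν ν)) (hC : Convex ℝ C)
    (hCν : ∀ ν, Convex ℝ (Cν ν)) (hlim : SetConverges Cν C) {x v : E}
    (hv : v ∈ normalCone C x) :
    ∃ xs vs : ℕ → E, Tendsto xs atTop (𝓝 x) ∧ Tendsto vs atTop (𝓝 v) ∧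
      ∀ ν, vs ν ∈ normalCone (Cν ν) (xs ν) := by
  have := FiniteDimensional.proper ℝ E
  have := FiniteDimensional.complete ℝ E
  -- The approximating normals are the residuals of projecting `x + v`.
  choose p hp using fun ν => exists_sub_mem_normalCone (hne ν) (hcl ν) (hCν ν) (x + v)
  obtain ⟨ws, hws, hwl⟩ := hlim.2 hv.1
  have hle : ∀ ν, ‖(x + v) - p ν‖ ≤ ‖(x + v) - ws ν‖ := fun ν => by
    have := norm_sub_le_of_sub_mem_normalCone (hCν ν) (hp ν) (hws ν)
    exact (sq_le_sq₀ (norm_nonneg _) (norm_nonneg _)).1 (by nlinarith [sq_nonneg ‖ws ν - p ν‖])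
  have hwl' : Tendsto (fun ν => ‖(x + v) - ws ν‖) atTop (𝓝 ‖(x + v) - x‖) :=
    (tendsto_const_nhds.sub hwl).norm
  obtain ⟨R, hR⟩ := hwl'.bddAbove_range
  have hpb : ∀ ν, p ν ∈ Metric.closedBall (x + v) R := fun ν => by
    rw [mem_closedBall_iff_norm']
    exact (hle ν).trans (hR ⟨ν, rfl⟩)
  have hpl : Tendsto p atTop (𝓝 x) := by
    refine tendsto_of_subseq_tendsto fun ns hns => ?_
    obtain ⟨χ, hχ, hχ'⟩ := strictMono_subseq_of_tendsto_atTop hns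
    obtain ⟨c, _, ψ, hψ, hc⟩ := tendsto_subseq_of_bounded Metric.isBounded_closedBall
      fun k => hpb (ns (χ k))
    refine ⟨fun k => χ (ψ k), ?_⟩
    have hcC : c ∈ C := hlim.1 ⟨fun k => ns (χ (ψ k)), hχ'.comp hψ, _, fun k => (hp _).1, hc⟩
    -- The cluster point `c` is no farther from `x + v` than `x`, which is the projection of `x + v`
    -- on `C` because `v` is normal there; hence `c = x`.
    have h1 : ‖(x + v) - c‖ ≤ ‖(x + v) - x‖ :=
      le_of_tendsto_of_tendsto' ((tendsto_const_nhds.sub hc).norm)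
        (hwl'.comp ((hχ'.comp hψ).tendsto_atTop)) fun k => hle _
    have h2 := norm_sub_le_of_sub_mem_normalCone hC (q := x + v) (p := x) (by simpa using hv) hcC
    have h3 : ‖c - x‖ = 0 := by nlinarith [norm_nonneg ((x + v) - c), norm_nonneg (c - x)]
    rw [norm_eq_zero, sub_eq_zero] at h3
    rw [← h3]
    exact hc
  exact ⟨p, fun ν => (x + v) - p ν, hpl, by simpa using hpl.const_sub (x + v), hp⟩

end NormalConeFacts

/-! ### Selections from convex hulls. -/

section ConvexHullSelections

variable {E : Type*} [NormedAddCommGroup E] [NormedSpace ℝ E] [FiniteDimensional ℝ E]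

/-- Carathéodory's theorem with a fixed number of points. -/
theorem exists_fin_combination_of_mem_convexHull {s : Set E} {x : E} (hx : x ∈ convexHull ℝ s) :
    ∃ w ∈ stdSimplex ℝ (Fin (Module.finrank ℝ E + 1)),
      ∃ z : Fin (Module.finrank ℝ E + 1) → E, (∀ i, z i ∈ s) ∧ ∑ i, w i • z i = x := by
  obtain ⟨ι, _, z, w, hz, hind, hw, hw1, rfl⟩ := eq_pos_convex_span_of_mem_convexHull hx
  have hcard : Fintype.card ι ≤ Fintype.card (Fin (Module.finrank ℝ E + 1)) := by
    rw [Fintype.card_fin]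
    exact hind.card_le_finrank_succ.trans (by gcongr; exact Submodule.finrank_le _)
  obtain ⟨e⟩ := Function.Embedding.nonempty_of_card_le hcard
  -- Surplus indices receive weight zero and the dummy point `z₀`.
  obtain ⟨z₀, hz₀⟩ := convexHull_nonempty_iff.1 ⟨_, hx⟩
  have hout : ∀ i ∉ Set.range e, Function.extend e w 0 i = 0 := fun i hi => by
    rw [Function.extend_apply' _ _ _ hi]; rfl
  refine ⟨Function.extend e w 0, ⟨fun i => ?_, ?_⟩, Function.extend e z fun _ => z₀,
    fun i => ?_, ?_⟩
  · by_cases hi : i ∈ Set.range e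
    · obtain ⟨j, rfl⟩ := hi
      rw [e.injective.extend_apply]
      exact (hw j).le
    · exact (hout i hi).ge
  · rw [← hw1]
    exact (Fintype.sum_of_injective e e.injective _ _ hout fun j => by
      rw [e.injective.extend_apply]).symm
  · by_cases hi : i ∈ Set.range e
    · obtain ⟨j, rfl⟩ := hi
      rw [e.injective.extend_apply]
      exact hz ⟨j, rfl⟩
    · rwa [Function.extend_apply' _ _ _ hi]
  · exact (Fintype.sum_of_injective e e.injective _ _ (fun i hi => by rw [hout i hi, zero_smul])
      fun j => by rw [e.injective.extend_apply, e.injective.extend_apply]).symm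

/-- If the selections of `A` are bounded with cluster points in a convex set, then so are the
selections of the convex hulls. -/
theorem convexHull_selection_bounded_cluster {A : ℕ → Set E} {K : Set E} (hK : Convex ℝ K)
    (hA : ∀ vs : ℕ → E, (∀ ν, vs ν ∈ A ν) → Bornology.IsBounded (Set.range vs) ∧
      ∀ v, MapClusterPt v atTop vs → v ∈ K)
    {ds : ℕ → E} (hds : ∀ ν, ds ν ∈ convexHull ℝ (A ν)) :
    Bornology.IsBounded (Set.range ds) ∧ ∀ v, MapClusterPt v atTop ds → v ∈ K := by
  choose w hw z hz hsum using fun ν => exists_fin_combination_of_mem_convexHull (hds ν)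
  have := FiniteDimensional.proper ℝ E
  have hzA := fun i => hA (fun ν => z ν i) fun ν => hz ν i
  have hzb : ∀ i, ∃ R : ℝ, ∀ ν, ‖z ν i‖ ≤ R := fun i => by
    obtain ⟨R, hR⟩ := (hzA i).1.exists_norm_le
    exact ⟨R, fun ν => hR _ ⟨ν, rfl⟩⟩
  choose R hR using hzb
  constructor
  · refine isBounded_iff_forall_norm_le.2 ⟨∑ i, R i, ?_⟩
    rintro _ ⟨ν, rfl⟩
    rw [← hsum ν]
    refine (norm_sum_le _ _).trans (Finset.sum_le_sum fun i _ => ?_)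
    have h0 := (hw ν).1 i
    have h1 : w ν i ≤ 1 := (hw ν).2 ▸
      Finset.single_le_sum (fun j _ => (hw ν).1 j) (Finset.mem_univ i)
    rw [norm_smul, Real.norm_of_nonneg h0]
    exact (mul_le_of_le_one_left (norm_nonneg _) h1).trans (hR i ν)
  · intro v hv
    obtain ⟨φ, hφ, hφv⟩ := hv.tendsto_subseq
    -- Weights and points range over compact sets, so they converge along a common subsequence; each
    -- limiting point lies in `K`.
    have hzc : IsCompact (Set.univ.pi fun i => Metric.closedBall (0 : E) (R i)) :=
      isCompact_univ_pi fun i => isCompact_closedBall _ _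
    obtain ⟨⟨w', z'⟩, hmem, ψ, hψ, hlim⟩ := ((isCompact_stdSimplex ℝ
        (Fin (Module.finrank ℝ E + 1))).prod hzc).tendsto_subseq
      (x := fun k => (w (φ k), z (φ k)))
      fun k => ⟨hw _, fun i _ => by simpa using hR i (φ k)⟩
    have hwl : Tendsto (fun k => w (φ (ψ k))) atTop (𝓝 w') := hlim.fst_nhds
    have hzl : Tendsto (fun k => z (φ (ψ k))) atTop (𝓝 z') := hlim.snd_nhds
    have hsl : Tendsto (fun k => ds (φ (ψ k))) atTop (𝓝 (∑ i, w' i • z' i)) := by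
      simp only [← hsum]
      exact tendsto_finsetSum _ fun i _ => (hwl.apply_nhds i).smul (hzl.apply_nhds i)
    rw [tendsto_nhds_unique (hφv.comp hψ.tendsto_atTop) hsl]
    refine hK.sum_mem (fun i _ => hmem.1.1 i) hmem.1.2 fun i _ => ?_
    exact (hzA i).2 _ (MapClusterPt.of_comp (hφ.comp hψ).tendsto_atTop
      (hzl.apply_nhds i).mapClusterPt)

end ConvexHullSelections

end GlobalApprox

namespace GlobalApprox

/-! ### Subgradients and epi-convergence. -/

section SubdifferentialFacts

variable {m : ℕ}

theorem toLp_toReal_mem_epi {h : Rn m → EReal} (hbot : ∀ z, h z ≠ ⊥) {z : Rn m} (hz : h z ≠ ⊤) :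
    WithLp.toLp 2 (z, (h z).toReal) ∈ epi h :=
  (EReal.coe_toReal hz (hbot z)).ge

theorem ne_top_of_mem_epi {h : Rn m → EReal} {p : WithLp 2 (Rn m × ℝ)} (hp : p ∈ epi h) :
    h p.fst ≠ ⊤ :=
  (lt_of_le_of_lt (show h p.fst ≤ (p.snd : EReal) from hp) (EReal.coe_lt_top _)).ne

/-- Subgradients in the sense of convex analysis. -/
theorem mem_subdiff_iff {h : Rn m → EReal} (hh : ProperLscConvex h) {z y : Rn m} :
    y ∈ subdiff h z ↔
      h z ≠ ⊤ ∧ ∀ p ∈ epi h, (h z).toReal + inner ℝ y (p.fst - z) ≤ p.snd := by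
  have hin : ∀ p : WithLp 2 (Rn m × ℝ),
      inner ℝ (WithLp.toLp 2 (y, (-1 : ℝ))) (p - WithLp.toLp 2 (z, (h z).toReal)) =
        inner ℝ y (p.fst - z) - (p.snd - (h z).toReal) := fun p => by
    rw [WithLp.prod_inner_apply]
    simp [sub_eq_add_neg]
  constructor
  · rintro ⟨_, hz, hy⟩
    refine ⟨hz, fun p hp => ?_⟩
    have := ((mem_normalCone_iff_of_convex hh.epi_convex).1 hy).2 p hp
    rw [hin] at this
    linarith
  · rintro ⟨hz, hy⟩
    refine ⟨hh.ne_bot z, hz, (mem_normalCone_iff_of_convex hh.epi_convex).2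
      ⟨toLp_toReal_mem_epi hh.ne_bot hz, fun p hp => ?_⟩⟩
    rw [hin]
    linarith [hy p hp]

/-- Downward normals to the epigraph are multiples of `(y, -1)` for subgradients `y`. -/
theorem smul_fst_mem_subdiff {h : Rn m → EReal} (hh : ProperLscConvex h)
    {p v : WithLp 2 (Rn m × ℝ)} (hv : v ∈ normalCone (epi h) p) (hneg : v.snd < 0) :
    (-v.snd)⁻¹ • v.fst ∈ subdiff h p.fst := by
  have hp : p ∈ epi h := hv.1
  have htop := ne_top_of_mem_epi hp
  have hle : (h p.fst).toReal ≤ p.snd := by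
    have : h p.fst ≤ (p.snd : EReal) := hp
    rwa [← EReal.coe_toReal htop (hh.ne_bot _), EReal.coe_le_coe_iff] at this
  -- Testing at the graph point over `p.fst` shows that `p` is not above the graph, since `v.snd <
  -- 0`.
  have hge := ((mem_normalCone_iff_of_convex hh.epi_convex).1 hv).2 _
    (toLp_toReal_mem_epi hh.ne_bot htop)
  rw [WithLp.prod_inner_apply] at hge
  simp only [WithLp.ofLp_sub, Prod.fst_sub, Prod.snd_sub, WithLp.ofLp_fst, WithLp.ofLp_snd,
    sub_self, inner_zero_right, zero_add, RCLike.inner_apply, conj_trivial] at hge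
  have heq : (h p.fst).toReal = p.snd := le_antisymm hle (by nlinarith)
  have hpos : 0 < (-v.snd)⁻¹ := by
    rw [inv_pos]
    linarith
  refine ⟨hh.ne_bot _, htop, ?_⟩
  have h1 : WithLp.toLp 2 (p.fst, (h p.fst).toReal) = p := by
    rw [heq]
    rfl
  have h2 : WithLp.toLp 2 ((-v.snd)⁻¹ • v.fst, (-1 : ℝ)) = (-v.snd)⁻¹ • v := by
    have : (-1 : ℝ) = (-v.snd)⁻¹ * v.snd := by
      rw [inv_neg, neg_mul, inv_mul_cancel₀ hneg.ne]
    rw [this]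
    rfl
  rw [h1, h2]
  exact smul_mem_normalCone hv hpos

/-- Projecting a point one unit below the graph on the epigraph leaves a residual that points
strictly downwards and rescales to a subgradient. -/
theorem exists_mem_subdiff {h : Rn m → EReal} (hh : ProperLscConvex h) :
    ∃ z y : Rn m, y ∈ subdiff h z := by
  obtain ⟨p₀, hp₀⟩ := hh.epi_nonempty
  set z := p₀.fst
  have hz : h z ≠ ⊤ := ne_top_of_mem_epi hp₀
  set r := (h z).toReal with hr
  have hrz : (r : EReal) = h z := EReal.coe_toReal hz (hh.ne_bot z)
  obtain ⟨p, hp⟩ := exists_sub_mem_normalCone hh.epi_nonempty hh.epi_closed hh.epi_convex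
    (WithLp.toLp 2 (z, r - 1))
  refine ⟨_, _, smul_fst_mem_subdiff hh hp ?_⟩
  have hineq := ((mem_normalCone_iff_of_convex hh.epi_convex).1 hp).2
  have hup : WithLp.toLp 2 (p.fst, p.snd + 1) ∈ epi h := by
    have : h p.fst ≤ (p.snd : EReal) := hp.1
    exact this.trans (EReal.coe_le_coe_iff.2 (le_add_of_nonneg_right zero_le_one))
  have h1 := hineq _ hup
  have h2 := hineq _ (toLp_toReal_mem_epi hh.ne_bot hz)
  rw [WithLp.prod_inner_apply] at h1 h2
  simp only [WithLp.ofLp_sub, Prod.fst_sub, Prod.snd_sub, WithLp.ofLp_fst, WithLp.ofLp_snd,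
    sub_self, inner_zero_right, zero_add, RCLike.inner_apply, conj_trivial,
    add_sub_cancel_left, one_mul] at h1 h2
  rw [WithLp.sub_snd]
  change r - 1 - p.snd < 0
  -- A horizontal residual would force `p.fst = z` with `p.snd = r - 1`, a point below the graph.
  refine lt_of_le_of_ne h1 fun h0 => ?_
  rw [h0, mul_zero, add_zero] at h2
  have hz' : z - p.fst = 0 := inner_self_eq_zero.1 (le_antisymm h2 real_inner_self_nonneg)
  rw [sub_eq_zero] at hz'
  have : h p.fst ≤ (p.snd : EReal) := hp.1
  rw [← hz', ← hrz, EReal.coe_le_coe_iff] at this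
  linarith

/-- Subgradients of an epi-limit of convex functions are limits of subgradients. -/
theorem exists_tendsto_subdiff {h : Rn m → EReal} {hν : ℕ → Rn m → EReal}
    (hh : ProperLscConvex h) (hhν : ∀ ν, ProperLscConvex (hν ν)) (hb : EpiConverges hν h)
    {z y : Rn m} (hy : y ∈ subdiff h z) :
    ∃ zs ys : ℕ → Rn m, Tendsto zs atTop (𝓝 z) ∧ Tendsto ys atTop (𝓝 y) ∧
      ∀ ν, ys ν ∈ subdiff (hν ν) (zs ν) := by
  obtain ⟨ps, vs, hps, hvs, hnor⟩ := exists_tendsto_normalCone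
    (fun ν => (hhν ν).epi_nonempty) (fun ν => (hhν ν).epi_closed) hh.epi_convex
    (fun ν => (hhν ν).epi_convex) hb hy.2.2
  choose z₀ y₀ hy₀ using fun ν => exists_mem_subdiff (hhν ν)
  have hp1 : Tendsto (fun ν => (ps ν).fst) atTop (𝓝 z) :=
    (((WithLp.prod_continuous_ofLp 2 _ _).fst).tendsto _).comp hps
  have hv1 : Tendsto (fun ν => (vs ν).fst) atTop (𝓝 y) :=
    (((WithLp.prod_continuous_ofLp 2 _ _).fst).tendsto _).comp hvs
  have hv2 : Tendsto (fun ν => (vs ν).snd) atTop (𝓝 (-1)) :=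
    (((WithLp.prod_continuous_ofLp 2 _ _).snd).tendsto _).comp hvs
  have hev : ∀ᶠ ν in atTop, (vs ν).snd < 0 := hv2.eventually_lt_const (by norm_num)
  -- Only finitely many indices fall back on the default pair `z₀ ν`, `y₀ ν`.
  refine ⟨fun ν => if (vs ν).snd < 0 then (ps ν).fst else z₀ ν,
    fun ν => if (vs ν).snd < 0 then (-(vs ν).snd)⁻¹ • (vs ν).fst else y₀ ν, ?_, ?_, fun ν => ?_⟩
  · exact hp1.congr' (hev.mono fun ν hν => (if_pos hν).symm)
  · have : Tendsto (fun ν => (-(vs ν).snd)⁻¹ • (vs ν).fst) atTop (𝓝 y) := by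
      simpa using (hv2.neg.inv₀ (by norm_num)).smul hv1
    exact this.congr' (hev.mono fun ν hν => (if_pos hν).symm)
  · by_cases hneg : (vs ν).snd < 0
    · simpa only [if_pos hneg] using smul_fst_mem_subdiff (hhν ν) (hnor ν) hneg
    · simpa only [if_neg hneg] using hy₀ ν

/-- The lower bound in epi-convergence, along a subsequence. -/
theorem EpiConverges.eventually_lt {h : Rn m → EReal} {hν : ℕ → Rn m → EReal}
    (hb : EpiConverges hν h) {φ : ℕ → ℕ} (hφ : StrictMono φ) {z : Rn m} {zs : ℕ → Rn m}
    (hzs : Tendsto zs atTop (𝓝 z)) {c : ℝ} (hc : (c : EReal) < h z) :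
    ∀ᶠ k in atTop, (c : EReal) < hν (φ k) (zs k) := by
  by_contra hcon
  obtain ⟨ψ, hψ, hle⟩ := extraction_of_frequently_atTop (not_eventually.1 hcon)
  have : WithLp.toLp 2 (z, c) ∈ epi h := by
    refine hb.1 ⟨φ ∘ ψ, hφ.comp hψ, fun k => WithLp.toLp 2 (zs (ψ k), c), fun k => not_lt.1 (hle k),
      ((WithLp.prod_continuous_toLp 2 _ _).tendsto _).comp
        ((hzs.comp hψ.tendsto_atTop).prodMk_nhds tendsto_const_nhds)⟩
  exact absurd hc (not_lt.2 this)

/-- The inner-limit half of epi-convergence, used to supply test points for subgradient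
inequalities. -/
theorem EpiConverges.exists_recovery {h : Rn m → EReal} {hν : ℕ → Rn m → EReal}
    (hb : EpiConverges hν h) {φ : ℕ → ℕ} (hφ : StrictMono φ) {p : WithLp 2 (Rn m × ℝ)}
    (hp : p ∈ epi h) :
    ∃ ps : ℕ → WithLp 2 (Rn m × ℝ), (∀ k, ps k ∈ epi (hν (φ k))) ∧
      Tendsto (fun k => (ps k).fst) atTop (𝓝 p.fst) ∧
      Tendsto (fun k => (ps k).snd) atTop (𝓝 p.snd) := by
  obtain ⟨ps, hps, hpl⟩ := hb.2 hp
  have hpl' := hpl.comp hφ.tendsto_atTop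
  exact ⟨ps ∘ φ, fun k => hps _, (((WithLp.prod_continuous_ofLp 2 _ _).fst).tendsto _).comp hpl',
    (((WithLp.prod_continuous_ofLp 2 _ _).snd).tendsto _).comp hpl'⟩

/-- Limits of subgradients along an epi-converging sequence are subgradients of the limit. -/
theorem mem_subdiff_of_tendsto {h : Rn m → EReal} {hν : ℕ → Rn m → EReal}
    (hh : ProperLscConvex h) (hhν : ∀ ν, ProperLscConvex (hν ν)) (hb : EpiConverges hν h)
    {φ : ℕ → ℕ} (hφ : StrictMono φ) {z y : Rn m} {zs ys : ℕ → Rn m}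
    (hzs : Tendsto zs atTop (𝓝 z)) (hys : Tendsto ys atTop (𝓝 y))
    (hsub : ∀ k, ys k ∈ subdiff (hν (φ k)) (zs k)) : y ∈ subdiff h z := by
  -- Stated in `EReal` because finiteness of `h z` is a consequence of this bound; real `c < h z`
  -- stand in for `h z`.
  have key : ∀ p ∈ epi h, h z ≤ ((p.snd - inner ℝ y (p.fst - z) : ℝ) : EReal) := by
    intro p hp
    obtain ⟨ps, hps, hp1, hp2⟩ := hb.exists_recovery hφ hp
    refine EReal.ge_of_forall_gt_iff_ge.1 fun c hc => ?_
    rw [EReal.coe_le_coe_iff]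
    refine ge_of_tendsto (hp2.sub (hys.inner (hp1.sub hzs))) ?_
    filter_upwards [hb.eventually_lt hφ hzs hc] with k hk
    obtain ⟨htop, hineq⟩ := (mem_subdiff_iff (hhν _)).1 (hsub k)
    rw [← EReal.coe_toReal htop ((hhν _).ne_bot _), EReal.coe_lt_coe_iff] at hk
    linarith [hineq _ (hps k)]
  obtain ⟨p₀, hp₀⟩ := hh.epi_nonempty
  have htop : h z ≠ ⊤ := ((key p₀ hp₀).trans_lt (EReal.coe_lt_top _)).ne
  refine (mem_subdiff_iff hh).2 ⟨htop, fun p hp => ?_⟩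
  have := key p hp
  rw [← EReal.coe_toReal htop (hh.ne_bot z), EReal.coe_le_coe_iff] at this
  linarith

theorem convex_effDom {h : Rn m → EReal} (hh : ProperLscConvex h) : Convex ℝ (effDom h) := by
  intro a ha b hb s t hs ht hst
  have := hh.epi_convex (toLp_toReal_mem_epi hh.ne_bot (ne_of_lt ha))
    (toLp_toReal_mem_epi hh.ne_bot (ne_of_lt hb)) hs ht hst
  exact (ne_top_of_mem_epi this).lt_top

/-- Limits of subgradients scaled by vanishing factors are normal to the effective domain. -/
theorem mem_normalCone_effDom_of_tendsto {h : Rn m → EReal} {hν : ℕ → Rn m → EReal}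
    (hh : ProperLscConvex h) (hhν : ∀ ν, ProperLscConvex (hν ν)) (hb : EpiConverges hν h)
    {φ : ℕ → ℕ} (hφ : StrictMono φ) {z y : Rn m} {zs ys : ℕ → Rn m} {t : ℕ → ℝ}
    (hz : z ∈ effDom h) (ht : ∀ k, 0 ≤ t k) (htl : Tendsto t atTop (𝓝 0))
    (hzs : Tendsto zs atTop (𝓝 z)) (hys : Tendsto (fun k => t k • ys k) atTop (𝓝 y))
    (hsub : ∀ k, ys k ∈ subdiff (hν (φ k)) (zs k)) : y ∈ normalCone (effDom h) z := by
  refine (mem_normalCone_iff_of_convex (convex_effDom hh)).2 ⟨hz, fun w hw => ?_⟩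
  obtain ⟨ps, hps, hp1, hp2⟩ := hb.exists_recovery hφ (toLp_toReal_mem_epi hh.ne_bot (ne_of_lt hw))
  -- Eventually `c` bounds the values at `zs k` from below, so the scaled subgradient inequality has
  -- a right side at most `t k * ((ps k).snd - c)`, which vanishes.
  obtain ⟨c, _, hc⟩ := EReal.lt_iff_exists_real_btwn.1 (bot_lt_iff_ne_bot.2 (hh.ne_bot z))
  have hl : Tendsto (fun k => inner ℝ (t k • ys k) ((ps k).fst - zs k)) atTop
      (𝓝 (inner ℝ y (w - z))) := hys.inner (hp1.sub hzs)
  have hr : Tendsto (fun k => t k * ((ps k).snd - c)) atTop (𝓝 0) := by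
    simpa using htl.mul (hp2.sub_const c)
  refine le_of_tendsto_of_tendsto hl hr ?_
  filter_upwards [hb.eventually_lt hφ hzs hc] with k hk
  obtain ⟨htop, hineq⟩ := (mem_subdiff_iff (hhν _)).1 (hsub k)
  rw [← EReal.coe_toReal htop ((hhν _).ne_bot _), EReal.coe_lt_coe_iff] at hk
  rw [real_inner_smul_left]
  exact mul_le_mul_of_nonneg_left (by linarith [hineq _ (hps k)]) (ht k)

end SubdifferentialFacts

end GlobalApprox

namespace GlobalApprox

/-! ### Near-stationarity and the mapping `S`. -/

section StationarityFacts

variable {n m : ℕ}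

theorem mem_multiplierSet_iff {X : Set (Rn n)} {D : Fin m → Rn n → Set (Rn n)} {x : Rn n}
    {y : Rn m} {u : Rn n} :
    u ∈ multiplierSet X D x y ↔ ∃ d : Fin m → Rn n, (∀ i, d i ∈ convexHull ℝ (D i x)) ∧
      ∃ v ∈ normalCone X x, ∑ i, y i • d i + v = u := by
  unfold multiplierSet
  rw [Set.mem_add]
  constructor
  · rintro ⟨a, ha, v, hv, rfl⟩
    obtain ⟨g, hg, rfl⟩ := (Set.mem_fintype_sum _ _).1 ha
    choose d hd hdg using fun i => Set.mem_smul_set.1 (hg i)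
    exact ⟨d, hd, v, hv, by simp only [hdg]⟩
  · rintro ⟨d, hd, v, hv, rfl⟩
    exact ⟨_, (Set.mem_fintype_sum _ _).2 ⟨fun i => y i • d i,
      fun i => Set.smul_mem_smul_set (hd i), rfl⟩, v, hv, rfl⟩

theorem mem_statMap_iff {X : Set (Rn n)} {f₀ : Rn n → ℝ} {h : Rn m → EReal} {F : Rn n → Rn m}
    {D : Fin m → Rn n → Set (Rn n)} {x : Rn n} {y z : Rn m} {s : Rn m × Rn m × Rn n} :
    s ∈ statMap X f₀ h F D x y z ↔ s.1 = F x - z ∧ s.2.1 + y ∈ subdiff h z ∧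
      ∃ d : Fin m → Rn n, (∀ i, d i ∈ convexHull ℝ (D i x)) ∧
        ∃ v ∈ normalCone X x, ∇ f₀ x + (∑ i, y i • d i + v) = s.2.2 := by
  simp only [statMap, Set.mem_prod, Set.mem_singleton_iff, Set.sub_singleton, Set.mem_image,
    Set.singleton_add, mem_multiplierSet_iff]
  refine and_congr_right fun _ => and_congr ?_ ?_
  · exact ⟨fun ⟨w, hw, he⟩ => by rwa [← he, sub_add_cancel], fun hw => ⟨_, hw, add_sub_cancel_right _ _⟩⟩
  · constructor
    · rintro ⟨_, ⟨d, hd, v, hv, rfl⟩, he⟩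
      exact ⟨d, hd, v, hv, he⟩
    · rintro ⟨d, hd, v, hv, he⟩
      exact ⟨_, ⟨d, hd, v, hv, rfl⟩, he⟩

/-- The slack `δ` avoids attainment of the infimum, and the product (sup) norm is dominated by the
Euclidean one. -/
theorem exists_mem_of_distZero_le {C : Set (Rn m × Rn m × Rn n)} {ε δ : ℝ} (hε : 0 ≤ ε)
    (hδ : 0 < δ) (h : distZero C ≤ ENNReal.ofReal ε) : ∃ s ∈ C, ‖s‖ ≤ ε + δ := by
  have hlt : distZero C < ENNReal.ofReal (ε + δ) :=
    h.trans_lt ((ENNReal.ofReal_lt_ofReal_iff (by linarith)).2 (by linarith))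
  simp only [distZero, iInf_lt_iff] at hlt
  obtain ⟨s, hs, hlt⟩ := hlt
  have hle := ((ENNReal.ofReal_lt_ofReal_iff (by linarith)).1 hlt).le
  refine ⟨s, hs, norm_prod_le_iff.2 ⟨?_, norm_prod_le_iff.2 ⟨?_, ?_⟩⟩⟩ <;>
    refine le_trans (Real.le_sqrt_of_sq_le ?_) hle <;>
    linarith [sq_nonneg ‖s.1‖, sq_nonneg ‖s.2.1‖, sq_nonneg ‖s.2.2‖]

/-- Near-stationarity provides vanishing elements of the approximating mappings. -/
theorem NearStationary.exists_tendsto_zero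
    {Sν : ℕ → Rn n → Rn m → Rn m → Set (Rn m × Rn m × Rn n)} {ε : ℕ → ℝ} {x : ℕ → Rn n}
    {y z : ℕ → Rn m} (hS : NearStationary Sν ε x y z) :
    ∃ s : ℕ → Rn m × Rn m × Rn n, (∀ ν, s ν ∈ Sν ν (x ν) (y ν) (z ν)) ∧
      Tendsto s atTop (𝓝 0) := by
  obtain ⟨hε, hεl, hdist⟩ := hS
  choose s hs hle using fun ν =>
    exists_mem_of_distZero_le (hε ν) (Nat.one_div_pos_of_nat (α := ℝ) (n := ν)) (hdist ν)
  exact ⟨s, hs, squeeze_zero_norm hle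
    (by simpa using hεl.add tendsto_one_div_add_atTop_nhds_zero_nat)⟩

theorem exists_nearStationary {Sν : ℕ → Rn n → Rn m → Rn m → Set (Rn m × Rn m × Rn n)}
    {x : ℕ → Rn n} {y z : ℕ → Rn m} {s : ℕ → Rn m × Rn m × Rn n}
    (hs : ∀ ν, s ν ∈ Sν ν (x ν) (y ν) (z ν)) (hsl : Tendsto s atTop (𝓝 0)) :
    ∃ ε, NearStationary Sν ε x y z := by
  refine ⟨fun ν => Real.sqrt (‖(s ν).1‖ ^ 2 + ‖(s ν).2.1‖ ^ 2 + ‖(s ν).2.2‖ ^ 2),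
    fun ν => Real.sqrt_nonneg _, ?_, fun ν => iInf₂_le (s ν) (hs ν)⟩
  have : Continuous fun s : Rn m × Rn m × Rn n =>
      Real.sqrt (‖s.1‖ ^ 2 + ‖s.2.1‖ ^ 2 + ‖s.2.2‖ ^ 2) := by fun_prop
  simpa [Function.comp_def] using (this.tendsto 0).comp hsl

/-- A selection converging along a subsequence can be altered off the subsequence so as to
converge. -/
theorem exists_tendsto_extension {E : Type*} [TopologicalSpace E] {C : ℕ → Set E} {x : E}
    (hx : x ∈ limInn C) {xs : ℕ → E} (hxs : ∀ ν, xs ν ∈ C ν) {φ : ℕ → ℕ} (hφ : StrictMono φ)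
    (hlim : Tendsto (xs ∘ φ) atTop (𝓝 x)) :
    ∃ xs' : ℕ → E, (∀ ν, xs' ν ∈ C ν) ∧ Tendsto xs' atTop (𝓝 x) ∧
      ∀ k, xs' (φ k) = xs (φ k) := by
  classical
  obtain ⟨ws, hws, hwl⟩ := hx
  refine ⟨fun ν => if ν ∈ Set.range φ then xs ν else ws ν, fun ν => ?_, fun U hU => ?_,
    fun k => if_pos ⟨k, rfl⟩⟩
  · dsimp only
    split_ifs
    exacts [hxs ν, hws ν]
  · obtain ⟨K, hK⟩ := eventually_atTop.1 (hlim.eventually_mem hU)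
    rw [mem_map]
    filter_upwards [hwl.eventually_mem hU, eventually_ge_atTop (φ K)] with ν hν hge
    by_cases hr : ν ∈ Set.range φ
    · obtain ⟨k, rfl⟩ := hr
      simpa only [Set.mem_preimage, if_pos (Set.mem_range_self k), Function.comp_apply] using
        hK k (hφ.le_iff_le.1 hge)
    · simpa only [Set.mem_preimage, if_neg hr] using hν

/-- Convergence of values and, along a further subsequence, of convex combinations of generalized
gradients. -/
theorem exists_subseq_tendsto_convexHull {X : Set (Rn n)} {Xν : ℕ → Set (Rn n)}
    {F : Rn n → Rn m} {Fν : ℕ → Rn n → Rn m} {D : Fin m → Rn n → Set (Rn n)}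
    {Dν : ℕ → Fin m → Rn n → Set (Rn n)} (ha : SetConverges Xν X)
    (hd : ∀ (i : Fin m) (x : Rn n) (xs vs : ℕ → Rn n),
      (∀ ν, xs ν ∈ Xν ν) → Tendsto xs atTop (𝓝 x) → (∀ ν, vs ν ∈ Dν ν i (xs ν)) →
      Tendsto (fun ν => Fν ν (xs ν) i) atTop (𝓝 (F x i)) ∧
      Bornology.IsBounded (Set.range vs) ∧
      ∀ v, MapClusterPt v atTop vs → v ∈ convexHull ℝ (D i x))
    (hne : ∀ ν i, ∀ x ∈ Xν ν, (Dν ν i x).Nonempty) {xs : ℕ → Rn n} (hxs : ∀ ν, xs ν ∈ Xν ν)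
    {φ : ℕ → ℕ} (hφ : StrictMono φ) {x : Rn n} (hlim : Tendsto (xs ∘ φ) atTop (𝓝 x))
    {ds : ℕ → Fin m → Rn n} (hds : ∀ ν i, ds ν i ∈ convexHull ℝ (Dν ν i (xs ν))) :
    Tendsto (fun k => Fν (φ k) (xs (φ k))) atTop (𝓝 (F x)) ∧
    ∃ ψ : ℕ → ℕ, StrictMono ψ ∧ ∃ d : Fin m → Rn n, (∀ i, d i ∈ convexHull ℝ (D i x)) ∧
      Tendsto (fun k => ds (φ (ψ k))) atTop (𝓝 d) := by
  classical
  have hx : x ∈ X := ha.1 ⟨φ, hφ, xs ∘ φ, fun k => hxs _, hlim⟩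
  -- Hypothesis (d) concerns full convergent sequences, so the subsequence is first completed to
  -- one.
  obtain ⟨xs', hxs', hlim', heq⟩ := exists_tendsto_extension (ha.2 hx) hxs hφ hlim
  choose e he using fun ν i => hne ν i (xs' ν) (hxs' ν)
  have hF : ∀ i, Tendsto (fun ν => Fν ν (xs' ν) i) atTop (𝓝 (F x i)) := fun i =>
    (hd i x xs' (fun ν => e ν i) hxs' hlim' fun ν => he ν i).1
  -- Where the completed sequence departs from `xs`, the arbitrary selection `e` fills in.
  set ds' : ℕ → Fin m → Rn n := fun ν i => if xs' ν = xs ν then ds ν i else e ν i with hds'def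
  have hds' : ∀ ν i, ds' ν i ∈ convexHull ℝ (Dν ν i (xs' ν)) := fun ν i => by
    simp only [hds'def]
    split_ifs with hs
    · rw [hs]
      exact hds ν i
    · exact subset_convexHull ℝ _ (he ν i)
  have hdsφ : ∀ k, ds' (φ k) = ds (φ k) := fun k => funext fun i => if_pos (heq k)
  have hsel := fun i => convexHull_selection_bounded_cluster (convex_convexHull ℝ (D i x))
    (fun vs hvs => (hd i x xs' vs hxs' hlim' hvs).2) fun ν => hds' ν i
  constructor
  · have h1 : Tendsto (fun ν => Fν ν (xs' ν)) atTop (𝓝 (F x)) :=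
      ((PiLp.continuous_toLp 2 fun _ : Fin m => ℝ).tendsto (F x).ofLp).comp
        (tendsto_pi_nhds.2 hF)
    exact (h1.comp hφ.tendsto_atTop).congr fun k => by simp only [Function.comp_apply, heq]
  · have hb : Bornology.IsBounded (Set.univ.pi fun i => Set.range fun ν => ds' ν i) :=
      Bornology.IsBounded.pi fun i => (hsel i).1
    obtain ⟨d, _, ψ, hψ, hdl⟩ := tendsto_subseq_of_bounded hb
      (x := fun k => ds' (φ k)) fun k i _ => ⟨φ k, rfl⟩
    refine ⟨ψ, hψ, d, fun i => (hsel i).2 _ (MapClusterPt.of_comp (hφ.comp hψ).tendsto_atTop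
      (hdl.apply_nhds i).mapClusterPt), ?_⟩
    exact hdl.congr fun k => hdsφ _

/-- Assembling near-stationary points from convergent ingredients. -/
theorem exists_nearStationary_of_tendsto {Xν : ℕ → Set (Rn n)}
    {h : Rn m → EReal} {hν : ℕ → Rn m → EReal} {f₀ : Rn n → ℝ} {f₀ν : ℕ → Rn n → ℝ}
    {F : Rn n → Rn m} {Fν : ℕ → Rn n → Rn m} {Dν : ℕ → Fin m → Rn n → Set (Rn n)}
    (hh : ProperLscConvex h) (hhν : ∀ ν, ProperLscConvex (hν ν)) (hb : EpiConverges hν h)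
    {xb : Rn n} {yb zb : Rn m} (hF : F xb = zb) (hy : yb ∈ subdiff h zb)
    {d : Fin m → Rn n} {v : Rn n} (hzero : ∇ f₀ xb + (∑ i, yb i • d i + v) = 0)
    {xs vs : ℕ → Rn n} {ds : ℕ → Fin m → Rn n}
    (hvs : ∀ ν, vs ν ∈ normalCone (Xν ν) (xs ν))
    (hds : ∀ ν i, ds ν i ∈ convexHull ℝ (Dν ν i (xs ν)))
    (hxl : Tendsto xs atTop (𝓝 xb)) (hvl : Tendsto vs atTop (𝓝 v))
    (hdl : Tendsto ds atTop (𝓝 d)) (hFl : Tendsto (fun ν => Fν ν (xs ν)) atTop (𝓝 (F xb)))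
    (hgl : Tendsto (fun ν => ∇ (f₀ν ν) (xs ν)) atTop (𝓝 (∇ f₀ xb))) :
    ∃ (x : ℕ → Rn n) (y z : ℕ → Rn m) (ε : ℕ → ℝ),
      Tendsto (fun ν => (x ν, y ν, z ν)) atTop (𝓝 (xb, yb, zb)) ∧
      NearStationary (fun ν => statMap (Xν ν) (f₀ν ν) (hν ν) (Fν ν) (Dν ν)) ε x y z := by
  obtain ⟨zs, ys, hzl, hyl, hsub⟩ := exists_tendsto_subdiff hh hhν hb hy
  have hyi : ∀ i, Tendsto (fun ν => ys ν i) atTop (𝓝 (yb i)) := fun i =>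
    ((EuclideanSpace.proj (𝕜 := ℝ) i).continuous.tendsto yb).comp hyl
  have h1 : Tendsto (fun ν => Fν ν (xs ν) - zs ν) atTop (𝓝 0) := by
    simpa [hF] using hFl.sub hzl
  have h3 : Tendsto (fun ν => ∇ (f₀ν ν) (xs ν) + (∑ i, ys ν i • ds ν i + vs ν)) atTop (𝓝 0) := by
    rw [← hzero]
    exact hgl.add ((tendsto_finsetSum _ fun i _ => (hyi i).smul (hdl.apply_nhds i)).add hvl)
  obtain ⟨ε, hε⟩ := exists_nearStationary
    (Sν := fun ν => statMap (Xν ν) (f₀ν ν) (hν ν) (Fν ν) (Dν ν)) (x := xs) (y := ys) (z := zs)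
    (s := fun ν => (Fν ν (xs ν) - zs ν, 0, ∇ (f₀ν ν) (xs ν) + (∑ i, ys ν i • ds ν i + vs ν)))
    (fun ν => mem_statMap_iff.2 ⟨rfl, by simpa using hsub ν, ds ν, hds ν, vs ν, hvs ν, rfl⟩)
    (h1.prodMk_nhds (tendsto_const_nhds.prodMk_nhds h3))
  exact ⟨xs, ys, zs, ε, hxl.prodMk_nhds (hyl.prodMk_nhds hzl), hε⟩

end StationarityFacts

end GlobalApprox

/-! ### Stability of near-stationary points. -/

theorem mainTheorem1 {n m : ℕ}
    (X : Set (Rn n)) (Xν : ℕ → Set (Rn n))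
    (h : Rn m → EReal) (hν : ℕ → Rn m → EReal)
    (f₀ : Rn n → ℝ) (f₀ν : ℕ → Rn n → ℝ)
    (F : Rn n → Rn m) (Fν : ℕ → Rn n → Rn m)
    (D : Fin m → Rn n → Set (Rn n)) (Dν : ℕ → Fin m → Rn n → Set (Rn n))
    -- standing assumptions on the data
    (hX_ne : X.Nonempty) (hX_cl : IsClosed X)
    (hXν_ne : ∀ ν, (Xν ν).Nonempty) (hXν_cl : ∀ ν, IsClosed (Xν ν))
    -- the sets are convex, or else they do not depend on `ν`
    (hconv : (Convex ℝ X ∧ ∀ ν, Convex ℝ (Xν ν)) ∨ ∀ ν, Xν ν = X)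
    (hh : ProperLscConvex h) (hhν : ∀ ν, ProperLscConvex (hν ν))
    (hf₀ : ContDiff ℝ 1 f₀) (hf₀ν : ∀ ν, ContDiff ℝ 1 (f₀ν ν))
    (hF : LocallyLipschitz F) (hFν : ∀ ν, LocallyLipschitz (Fν ν))
    -- (a), (b)
    (ha : SetConverges Xν X)
    (hb : EpiConverges hν h)
    -- (c)
    (hc : ∀ (x : Rn n) (xs : ℕ → Rn n), (∀ ν, xs ν ∈ Xν ν) → Tendsto xs atTop (𝓝 x) →
      Tendsto (fun ν => f₀ν ν (xs ν)) atTop (𝓝 (f₀ x)) ∧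
      Tendsto (fun ν => ∇ (f₀ν ν) (xs ν)) atTop (𝓝 (∇ f₀ x)))
    -- (d)
    (hd : ∀ (i : Fin m) (x : Rn n) (xs vs : ℕ → Rn n),
      (∀ ν, xs ν ∈ Xν ν) → Tendsto xs atTop (𝓝 x) → (∀ ν, vs ν ∈ Dν ν i (xs ν)) →
      Tendsto (fun ν => Fν ν (xs ν) i) atTop (𝓝 (F x i)) ∧
      Bornology.IsBounded (Set.range vs) ∧
      ∀ v, MapClusterPt v atTop vs → v ∈ convexHull ℝ (D i x)) :
    -- (i)
    ((∀ ν i, ∀ x ∈ Xν ν, (Dν ν i x).Nonempty) →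
      ∀ (ε : ℕ → ℝ) (x : ℕ → Rn n) (y z : ℕ → Rn m),
        NearStationary (fun ν => statMap (Xν ν) (f₀ν ν) (hν ν) (Fν ν) (Dν ν)) ε x y z →
      ∀ (φ : ℕ → ℕ) (xb : Rn n), StrictMono φ → Tendsto (x ∘ φ) atTop (𝓝 xb) →
      (F xb ∈ effDom h → BasicQualification X h F D xb) →
      (F xb ∉ effDom h → InfeasQualification X D xb) →
      ∃ yb zb : Rn m, 0 ∈ statMap X f₀ h F D xb yb zb) ∧
    -- (ii)
    ((∀ ν i, ∀ x ∈ Xν ν, (Dν ν i x).Nonempty) →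
      ∀ (ε : ℕ → ℝ) (x : ℕ → Rn n) (y z : ℕ → Rn m),
        NearStationary (fun ν => statMap (Xν ν) (f₀ν ν) (hν ν) (Fν ν) (Dν ν)) ε x y z →
      ∀ (xb : Rn n) (yb zb : Rn m),
      MapClusterPt (xb, yb, zb) atTop (fun ν => (x ν, y ν, z ν)) → 0 ∈ statMap X f₀ h F D xb yb zb) ∧
    -- (iii)
    (ContDiff ℝ 1 F → (∀ ν, ContDiff ℝ 1 (Fν ν)) →
      (∀ i x, D i x = {∇ (fun x' => F x' i) x}) →
      (∀ ν i x, Dν ν i x = {∇ (fun x' => Fν ν x' i) x}) →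
      ZerosApproximable (statMap X f₀ h F D)
        (fun ν => statMap (Xν ν) (f₀ν ν) (hν ν) (Fν ν) (Dν ν))) ∧
    -- (iv)
    ((∀ ν, Xν ν = X) → (∀ ν, Fν ν = F) → (∀ ν i, Dν ν i = D i) →
      ZerosApproximable (statMap X f₀ h F D)
        (fun ν => statMap (Xν ν) (f₀ν ν) (hν ν) (Fν ν) (Dν ν))) := by
  -- data extracted from near-stationary points
  have hdata : ∀ (ε : ℕ → ℝ) (x : ℕ → Rn n) (y z : ℕ → Rn m),
      NearStationary (fun ν => statMap (Xν ν) (f₀ν ν) (hν ν) (Fν ν) (Dν ν)) ε x y z →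
      ∃ (s : ℕ → Rn m × Rn m × Rn n) (d : ℕ → Fin m → Rn n) (v : ℕ → Rn n),
        Tendsto s atTop (𝓝 0) ∧ (∀ ν, (s ν).1 = Fν ν (x ν) - z ν) ∧
        (∀ ν, (s ν).2.1 + y ν ∈ subdiff (hν ν) (z ν)) ∧
        (∀ ν i, d ν i ∈ convexHull ℝ (Dν ν i (x ν))) ∧
        (∀ ν, v ν ∈ normalCone (Xν ν) (x ν)) ∧
        ∀ ν, ∇ (f₀ν ν) (x ν) + (∑ i, y ν i • d ν i + v ν) = (s ν).2.2 := by
    intro ε x y z hS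
    obtain ⟨s, hs, hsl⟩ := hS.exists_tendsto_zero
    choose h1 h2 d hdm v hv h3 using fun ν => mem_statMap_iff.1 (hs ν)
    exact ⟨s, d, v, hsl, h1, h2, hdm, hv, h3⟩
  have hgrad : ∀ {x : ℕ → Rn n} {φ : ℕ → ℕ} {xb : Rn n}, (∀ ν, x ν ∈ Xν ν) → StrictMono φ →
      Tendsto (x ∘ φ) atTop (𝓝 xb) →
      Tendsto (fun k => ∇ (f₀ν (φ k)) (x (φ k))) atTop (𝓝 (∇ f₀ xb)) := by
    intro x φ xb hx hφ hlim
    obtain ⟨x', hx', hl', heq⟩ := exists_tendsto_extension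
      (ha.2 (ha.1 ⟨φ, hφ, x ∘ φ, fun k => hx _, hlim⟩)) hx hφ hlim
    exact ((hc xb x' hx' hl').2.comp hφ.tendsto_atTop).congr fun k => by
      simp only [Function.comp_apply, heq]
  have hproj : ∀ {ys : ℕ → Rn m} {yb : Rn m}, Tendsto ys atTop (𝓝 yb) → ∀ i,
      Tendsto (fun k => ys k i) atTop (𝓝 (yb i)) := fun {_ yb} hys i =>
    ((EuclideanSpace.proj (𝕜 := ℝ) i).continuous.tendsto yb).comp hys
  have hii : (∀ ν i, ∀ x ∈ Xν ν, (Dν ν i x).Nonempty) →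
      ∀ (ε : ℕ → ℝ) (x : ℕ → Rn n) (y z : ℕ → Rn m),
        NearStationary (fun ν => statMap (Xν ν) (f₀ν ν) (hν ν) (Fν ν) (Dν ν)) ε x y z →
      ∀ (xb : Rn n) (yb zb : Rn m),
      MapClusterPt (xb, yb, zb) atTop (fun ν => (x ν, y ν, z ν)) →
        0 ∈ statMap X f₀ h F D xb yb zb := by
    intro hne ε x y z hS xb yb zb hcl
    obtain ⟨s, d, v, hsl, h1, h2, hdm, hv, h3⟩ := hdata ε x y z hS
    obtain ⟨φ, hφ, hlim⟩ := hcl.tendsto_subseq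
    have hxl : Tendsto (x ∘ φ) atTop (𝓝 xb) := hlim.fst_nhds
    obtain ⟨hFl, ψ, hψ, db, hdb, hdl⟩ :=
      exists_subseq_tendsto_convexHull ha hd hne (fun ν => (hv ν).1) hφ hxl hdm
    have hθ : StrictMono (φ ∘ ψ) := hφ.comp hψ
    have hyl : Tendsto (fun k => y (φ (ψ k))) atTop (𝓝 yb) :=
      hlim.snd_nhds.fst_nhds.comp hψ.tendsto_atTop
    have hzl : Tendsto (fun k => z (φ k)) atTop (𝓝 zb) := hlim.snd_nhds.snd_nhds
    have hxl' : Tendsto (x ∘ (φ ∘ ψ)) atTop (𝓝 xb) := hxl.comp hψ.tendsto_atTop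
    have hsl' := hsl.comp hθ.tendsto_atTop
    have hs0 : Tendsto (fun k => (s (φ k)).1) atTop (𝓝 0) :=
      (hsl.comp hφ.tendsto_atTop).fst_nhds
    have hs1 : Tendsto (fun k => (s (φ (ψ k))).2.1) atTop (𝓝 0) := hsl'.snd_nhds.fst_nhds
    have hs2 : Tendsto (fun k => (s (φ (ψ k))).2.2) atTop (𝓝 0) := hsl'.snd_nhds.snd_nhds
    have hFz : F xb - zb = 0 := by
      refine tendsto_nhds_unique (hFl.sub hzl) (hs0.congr fun k => h1 _)
    have hsub : yb ∈ subdiff h zb :=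
      mem_subdiff_of_tendsto hh hhν hb hθ (hzl.comp hψ.tendsto_atTop)
        (by simpa using hs1.add hyl) fun k => h2 _
    -- The normals converge because the stationarity equation expresses them through convergent
    -- terms.
    have hvl : Tendsto (fun k => v (φ (ψ k))) atTop
        (𝓝 (0 - ∇ f₀ xb - ∑ i, yb i • db i)) := by
      refine ((hs2.sub (hgrad (fun ν => (hv ν).1) hθ hxl')).sub
        (tendsto_finsetSum _ fun i _ => (hproj hyl i).smul (hdl.apply_nhds i))).congr fun k => ?_
      rw [← h3]
      simp only [Function.comp_apply]
      abel
    have hvX := mem_normalCone_of_setConverges hconv ha hθ hxl' hvl fun k => hv _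
    refine mem_statMap_iff.2 ⟨hFz.symm, by simpa using hsub, db, hdb, _, hvX, ?_⟩
    simp only [Prod.snd_zero]
    abel
  refine ⟨?_, hii, ?_, ?_⟩
  · intro hne ε x y z hS φ xb hφ hxl hBQ hIQ
    obtain ⟨s, d, v, hsl, h1, h2, hdm, hv, h3⟩ := hdata ε x y z hS
    obtain ⟨hFl, ψ, hψ, db, hdb, hdl⟩ :=
      exists_subseq_tendsto_convexHull ha hd hne (fun ν => (hv ν).1) hφ hxl hdm
    have hzl : Tendsto (fun k => z (φ k)) atTop (𝓝 (F xb)) := by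
      have := hFl.sub (hsl.comp hφ.tendsto_atTop).fst_nhds
      simp only [Prod.fst_zero, sub_zero] at this
      exact this.congr fun k => by simp [h1]
    by_cases hT : Tendsto (fun k => ‖y (φ (ψ k))‖) atTop atTop
    · exfalso
      -- Adding `1` keeps the scaling positive even at `y ν = 0`; the scaled norm `1 - t ν` still
      -- tends to `1`.
      set t : ℕ → ℝ := fun ν => (‖y ν‖ + 1)⁻¹ with ht
      have htpos : ∀ ν, 0 < t ν := fun ν => by positivity
      have htl : Tendsto (fun k => t (φ (ψ k))) atTop (𝓝 0) :=
        (tendsto_atTop_add_const_right _ 1 hT).inv_tendsto_atTop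
      have hty : ∀ ν, ‖t ν • y ν‖ = 1 - t ν := fun ν => by
        rw [norm_smul, Real.norm_of_nonneg (htpos ν).le]
        have : ‖y ν‖ + 1 ≠ 0 := by positivity
        simp only [ht]
        field_simp
        ring
      obtain ⟨yb, _, χ, hχ, hyl⟩ := tendsto_subseq_of_bounded
        (Metric.isBounded_closedBall (x := (0 : Rn m)) (r := 1))
        (x := fun k => t (φ (ψ k)) • y (φ (ψ k))) fun k => by
          rw [mem_closedBall_zero_iff, hty]
          linarith [htpos (φ (ψ k))]
      set θ : ℕ → ℕ := fun k => φ (ψ (χ k)) with hθdef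
      have hψχ : StrictMono (ψ ∘ χ) := hψ.comp hχ
      have hθ : StrictMono θ := hφ.comp hψχ
      have htl' : Tendsto (fun k => t (θ k)) atTop (𝓝 0) := htl.comp hχ.tendsto_atTop
      have hyl' : Tendsto (fun k => t (θ k) • y (θ k)) atTop (𝓝 yb) := hyl
      have hyb : ‖yb‖ = 1 := by
        refine tendsto_nhds_unique hyl'.norm ?_
        simp only [hty]
        simpa using htl'.const_sub 1
      have hxl' : Tendsto (x ∘ θ) atTop (𝓝 xb) := hxl.comp hψχ.tendsto_atTop
      have hzl' : Tendsto (fun k => z (θ k)) atTop (𝓝 (F xb)) := hzl.comp hψχ.tendsto_atTop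
      have hdl' : Tendsto (fun k => d (θ k)) atTop (𝓝 db) := hdl.comp hχ.tendsto_atTop
      have hsl' := hsl.comp hθ.tendsto_atTop
      have hs1 : Tendsto (fun k => (s (θ k)).2.1) atTop (𝓝 0) := hsl'.snd_nhds.fst_nhds
      have hs2 : Tendsto (fun k => (s (θ k)).2.2) atTop (𝓝 0) := hsl'.snd_nhds.snd_nhds
      have hvl : Tendsto (fun k => t (θ k) • v (θ k)) atTop (𝓝 (-∑ i, yb i • db i)) := by
        have hsmall : Tendsto (fun k => t (θ k) • ((s (θ k)).2.2 - ∇ (f₀ν (θ k)) (x (θ k))))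
            atTop (𝓝 0) := by
          simpa using htl'.smul (hs2.sub (hgrad (fun ν => (hv ν).1) hθ hxl'))
        have := hsmall.sub (tendsto_finsetSum Finset.univ fun i _ =>
          (hproj hyl' i).smul (hdl'.apply_nhds i))
        rw [zero_sub] at this
        refine this.congr fun k => ?_
        simp only [← h3, PiLp.smul_apply, smul_assoc, ← Finset.smul_sum, ← smul_sub]
        congr 1
        abel
      have hvX := mem_normalCone_of_setConverges hconv ha hθ hxl' hvl
        fun k => smul_mem_normalCone (hv _) (htpos _)
      have hmult : 0 ∈ multiplierSet X D xb yb :=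
        mem_multiplierSet_iff.2 ⟨db, hdb, _, hvX, add_neg_cancel _⟩
      have hy0 : yb = 0 := by
        by_cases hdom : F xb ∈ effDom h
        · refine hBQ hdom yb ?_ hmult
          refine mem_normalCone_effDom_of_tendsto hh hhν hb hθ hdom (fun k => (htpos (θ k)).le)
            htl' hzl' ?_ fun k => h2 _
          simpa [smul_add] using (htl'.smul hs1).add hyl'
        · exact hIQ hdom yb hmult
      simp [hy0] at hyb
    -- Norms not tending to infinity stay below some `R` infinitely often, which yields a cluster
    -- point for (ii).
    · obtain ⟨R, hR⟩ := not_forall.1 (mt tendsto_atTop.2 hT)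
      have hfreq : ∃ᶠ k in atTop, y (φ (ψ k)) ∈ Metric.closedBall (0 : Rn m) R :=
        (not_eventually.1 hR).mono fun k hk => by
          rw [mem_closedBall_zero_iff]
          exact (not_le.1 hk).le
      obtain ⟨yb, _, χ, hχ, hyl⟩ :=
        tendsto_subseq_of_frequently_bounded Metric.isBounded_closedBall hfreq
      have hψχ : StrictMono (ψ ∘ χ) := hψ.comp hχ
      refine ⟨yb, F xb, hii hne ε x y z hS xb yb (F xb) ?_⟩
      refine MapClusterPt.of_comp (hφ.comp hψχ).tendsto_atTop (Tendsto.mapClusterPt ?_)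
      exact (hxl.comp hψχ.tendsto_atTop).prodMk_nhds
        (hyl.prodMk_nhds (hzl.comp hψχ.tendsto_atTop))
  · intro _ _ hD hDν xb yb zb h0
    obtain ⟨h1, h2, d, hdm, v, hv, h3⟩ := mem_statMap_iff.1 h0
    have hd0 : ∀ i, d i = ∇ (fun x' => F x' i) xb := fun i => by
      have := hdm i
      rwa [hD, convexHull_singleton, Set.mem_singleton_iff] at this
    obtain ⟨xs, vs, hxl, hvl, hvs⟩ : ∃ xs vs : ℕ → Rn n, Tendsto xs atTop (𝓝 xb) ∧
        Tendsto vs atTop (𝓝 v) ∧ ∀ ν, vs ν ∈ normalCone (Xν ν) (xs ν) := by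
      rcases hconv with ⟨hcX, hcXν⟩ | heq
      · exact exists_tendsto_normalCone hXν_ne hXν_cl hcX hcXν ha hv
      · exact ⟨fun _ => xb, fun _ => v, tendsto_const_nhds, tendsto_const_nhds,
          fun ν => by rwa [heq ν]⟩
    have hlim := fun i => hd i xb xs (fun ν => ∇ (fun x' => Fν ν x' i) (xs ν))
      (fun ν => (hvs ν).1) hxl fun ν => by rw [hDν]; rfl
    refine exists_nearStationary_of_tendsto hh hhν hb (sub_eq_zero.1 h1.symm) (by simpa using h2)
      h3 hvs (fun ν i => subset_convexHull ℝ _ (by rw [hDν]; rfl))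
      (ds := fun ν i => ∇ (fun x' => Fν ν x' i) (xs ν)) hxl hvl ?_ ?_
      (hc xb xs (fun ν => (hvs ν).1) hxl).2
    · refine tendsto_pi_nhds.2 fun i => ?_
      rw [hd0 i]
      -- The limiting hull is a singleton, so the bounded gradients have only one possible cluster
      -- point and converge.
      refine (hlim i).2.1.isCompact_closure.tendsto_nhds_of_unique_mapClusterPt
        (Eventually.of_forall fun ν => subset_closure ⟨ν, rfl⟩) fun w _ hw => ?_
      simpa [hD] using (hlim i).2.2 w hw
    · exact ((PiLp.continuous_toLp 2 fun _ : Fin m => ℝ).tendsto (F xb).ofLp).comp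
        (tendsto_pi_nhds.2 fun i => (hlim i).1)
  · intro hXX hFF hDD xb yb zb h0
    obtain ⟨h1, h2, d, hdm, v, hv, h3⟩ := mem_statMap_iff.1 h0
    -- With constraint data fixed, `xb`, `v` and `d` are kept constant; only `y` and `z` follow the
    -- subgradients of `hν`.
    refine exists_nearStationary_of_tendsto hh hhν hb (sub_eq_zero.1 h1.symm) (by simpa using h2)
      h3 (xs := fun _ => xb) (vs := fun _ => v) (ds := fun _ => d) (fun ν => by rwa [hXX ν])
      (fun ν i => by rw [hDD]; exact hdm i) tendsto_const_nhds tendsto_const_nhds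
      tendsto_const_nhds ?_ (hc xb _ (fun ν => by rw [hXX ν]; exact hv.1) tendsto_const_nhds).2
    simp only [hFF]
    exact tendsto_const_nhds
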